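/- **Setting.** A dataset is a finite multiset of examples from a set $X$; two datasets are adjacent if one arises from the other by adding one example. A randomized algorithm $M$ is $(\varepsilon,\delta)$-DP if $\Pr[M(D)\in S]\le e^{\varepsilon}\Pr[M(D')\in S]+\delta$ for all adjacent $D,D'$ and all events $S$. For probability measures let $\mathscr D_{e^{\varepsilon}}(P\|Q)=\sup_S\,(P(S)-e^{\varepsilon}Q(S))$ over events $S$. There are finitely many categorical features $j=1,\dots,p$; feature $j$ has $c_j$ buckets, and every example lies in at most one bucket of each feature. **DP-FEST.** *(Bucket selection.)* For each feature $j$ independently, compute the number of examples of $D$ in each of the $c_j$ buckets, add independent Gumbel noise of location $0$ and scale $b_j>0$ to every count, and let $r_j$ be the set of the $k_j$ buckets with the largest noisy counts (all buckets if $k_j\ge c_j$). *(DP-SGD on the selected buckets.)* The parameters $\theta$ consist of finitely many non-embedding parameters and, for each feature $j$, an embedding table with one row per bucket. Let $g_r(x,\theta)$ be the per-example gradient (any map that is measurable in $\theta$), which may depend on the selection $r=(r_j)_j$. Draw $\theta_0$ from a distribution that does not depend on the data. For $t=1,\dots,T$, form a batch $\mathcal B_t$ by including every example of $D$ independently with probability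 $\gamma\in(0,1]$, and put $$G_t=\frac1B\Big(\sum_{x\in\mathcal B_t}\big[\pi_r\, g_r(x,\theta_{t-1})\big]_C+\sigma C\,\pi_r Z_t\Big),\qquad \theta_t=\theta_{t-1}-\eta\,G_t ,$$ where $\pi_r$ sets the embedding rows of all non-selected buckets to zero, $[v]_C=v/\max(1,\|v\|_2/C)$ with clipping norm $C>0$, the $Z_t$ are independent standard Gaussian vectors, $\sigma>0$ is the noise multiplier, $\eta\in\mathbb R$ is the learning rate and $B\ge1$ is a fixed nominal batch size. **Theorem.** Let $P=(1-\gamma)\,\mathcal N(0,\sigma^2)+\gamma\,\mathcal N(1,\sigma^2)$ and $Q=\mathcal N(0,\sigma^2)$, and let $\varepsilon_1\ge\sum_j k_j/b_j$ (for a single feature: Gumbel noise of scale at least $k/\varepsilon_1$, when $\varepsilon_1>0$). Let $\varepsilon,\delta\in\mathbb R$ be such that $$\max\big\{\mathscr D_{e^{\varepsilon-\varepsilon_1}}(P^{\times T}\|Q^{\times T}),\ \mathscr D_{e^{\varepsilon-\varepsilon_1}}(Q^{\times T}\|P^{\times T})\big\}\le\delta .$$ Then the bucket selection $D\mapsto r$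 is $(\varepsilon_1,0)$-DP, and DP-FEST is $(\varepsilon,\delta)$-DP. The latter holds both for the trained model $(r,\theta_T)$ and for the full transcript $(r,\theta_0,G_1,\dots,G_T)$. -/

import Mathlib

open MeasureTheory ProbabilityTheory
open scoped ENNReal

noncomputable section

namespace DPFest

/-! ### Differential privacy and the hockey-stick divergence -/

/-- Two datasets (finite multisets of examples) are adjacent if one is obtained from the other
by adding one example. -/
def Adjacent {X : Type*} (D D' : Multiset X) : Prop :=
  (∃ x, D = x ::ₘ D') ∨ (∃ x, D' = x ::ₘ D)

/-- `(ε, δ)`-differential privacy of a randomized algorithm, given by its output law on each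
dataset: `Pr[M D ∈ S] ≤ e ^ ε * Pr[M D' ∈ S] + δ` for all adjacent `D`, `D'` and all events. -/
def IsDP {X Ω : Type*} [MeasurableSpace Ω] (M : Multiset X → Measure Ω) (ε δ : ℝ) : Prop :=
  ∀ D D' : Multiset X, Adjacent D D' → ∀ S : Set Ω, MeasurableSet S →
    M D S ≤ ENNReal.ofReal (Real.exp ε) * M D' S + ENNReal.ofReal δ

/-- The `e ^ ε`-hockey-stick divergence `sup_S (P S - e ^ ε * Q S)`, the supremum being over
events. For finite measures the supremum is over a nonempty bounded set of reals. -/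
def hockeyStick {Ω : Type*} [MeasurableSpace Ω] (ε : ℝ) (P Q : Measure Ω) : ℝ :=
  ⨆ S : {S : Set Ω // MeasurableSet S}, (P.real S.1 - Real.exp ε * Q.real S.1)

/-- `N(0, σ²)`. -/
def pairQ (σ : ℝ) : Measure ℝ := gaussianReal 0 (Real.toNNReal (σ ^ 2))

/-- `(1 - γ) N(0, σ²) + γ N(1, σ²)`. -/
def pairP (γ σ : ℝ) : Measure ℝ :=
  ENNReal.ofReal (1 - γ) • gaussianReal 0 (Real.toNNReal (σ ^ 2)) +
    ENNReal.ofReal γ • gaussianReal 1 (Real.toNNReal (σ ^ 2))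

/-- The `T`-fold product `P × ⋯ × P`. -/
def power (P : Measure ℝ) (T : ℕ) : Measure (Fin T → ℝ) := Measure.pi fun _ => P

/-! ### One-shot top-`k` selection with Gumbel noise -/

/-- The Gumbel distribution with location `0` and scale `b` (for `b > 0`). -/
def gumbel (b : ℝ) : Measure ℝ :=
  volume.withDensity fun x => ENNReal.ofReal (b⁻¹ * Real.exp (-(x / b + Real.exp (-(x / b)))))

/-- The number of examples of `D` whose bucket is `i`; an example with bucket `none` has no
value for the feature at hand. -/
def bucketCount {X : Type*} {c : ℕ} (bucket : X → Option (Fin c)) (D : Multiset X)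
    (i : Fin c) : ℕ :=
  (D.map bucket).count (some i)

/-- The indices of the `k` largest entries of `v`, ties being broken in favour of the smaller
index (all indices if `k ≥ c`). -/
def topK {c : ℕ} (k : ℕ) (v : Fin c → ℝ) : Set (Fin c) :=
  {i | Set.ncard {j | v i < v j ∨ (v i = v j ∧ j < i)} < k}

/-- One-shot top-`k` selection: add independent Gumbel noise of scale `b` to each bucket count
and return the `k` buckets with the largest noisy counts. -/
def gumbelTopK {X : Type*} {c : ℕ} (bucket : X → Option (Fin c)) (k : ℕ) (b : ℝ)
    (D : Multiset X) : Measure (Set (Fin c)) :=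
  (Measure.pi fun _ : Fin c => gumbel b).map
    fun z => topK k fun i => (bucketCount bucket D i : ℝ) + z i

/-- A choice of a set of buckets for each of `p` categorical features, the `j`-th having
`c j` buckets. -/
abbrev Selection {p : ℕ} (c : Fin p → ℕ) : Type := (j : Fin p) → Set (Fin (c j))

/-- The selection stage: independent one-shot top-`k j` selection with noise scale `b j` for each
feature `j`. -/
def selectBuckets {X : Type*} {p : ℕ} {c : Fin p → ℕ}
    (bucket : (j : Fin p) → X → Option (Fin (c j))) (k : Fin p → ℕ) (b : Fin p → ℝ)
    (D : Multiset X) : Measure (Selection c) :=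
  Measure.pi fun j => gumbelTopK (bucket j) (k j) (b j) D

/-! ### DP-SGD on the selected buckets -/

/-- The model parameters, with the Euclidean norm: `m` parameters outside the embedding layers,
and for each feature `j` an embedding table with `c j` rows (buckets) and `d j` columns. -/
abbrev Params (m : ℕ) {p : ℕ} (c d : Fin p → ℕ) : Type :=
  EuclideanSpace ℝ (Fin m ⊕ (j : Fin p) × (Fin (c j) × Fin (d j)))

variable {X : Type*} {m p : ℕ} {c d : Fin p → ℕ}

open Classical in
/-- Set the embedding rows of all buckets that are not selected to zero. -/
def mask (r : Selection c) (v : Params m c d) : Params m c d :=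
  WithLp.toLp 2 fun a => match a with
    | Sum.inl i => v (Sum.inl i)
    | Sum.inr q => if q.2.1 ∈ r q.1 then v (Sum.inr q) else 0

/-- Clipping of the Euclidean norm to at most `C`. -/
def clip (C : ℝ) (v : Params m c d) : Params m c d := (max 1 (‖v‖ / C))⁻¹ • v

/-- Poisson subsampling followed by a mechanism `f`: every element of `D` is included in the
batch independently with probability `γ`, and `f` is run on the batch. (`D.powerset` lists the
`2 ^ card D` possible batches with multiplicity.) -/
def poissonSubsample {Ω : Type*} [MeasurableSpace Ω] (γ : ℝ) (f : Multiset X → Measure Ω)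
    (D : Multiset X) : Measure Ω :=
  (D.powerset.map fun A =>
    ENNReal.ofReal (γ ^ A.card * (1 - γ) ^ (D.card - A.card)) • f A).sum

/-- The law of the noisy gradient of the batch `A` at `θ`: the per-example gradients are restricted
to the selected rows and clipped to norm `C`, and Gaussian noise of standard deviation `σ * C` is
added to their sum in every coordinate outside the rows that are not selected; the result is
divided by the nominal batch size `B`. -/
def noisyGradient (grad : X → Params m c d → Params m c d) (r : Selection c) (C σ : ℝ) (B : ℕ)
    (θ : Params m c d) (A : Multiset X) : Measure (Params m c d) :=
  (stdGaussian (Params m c d)).map fun z =>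
    (B : ℝ)⁻¹ • ((A.map fun x => clip C (mask r (grad x θ))).sum + (σ * C) • mask r z)

/-- DP-SGD with Poisson subsampling, run for `T` steps from `θ` on the dataset `D`, only the
selected embedding rows being trained: the joint law of the `T` noisy gradients `G`, each
computed at the current parameters, which are then updated to `θ - η • G`. -/
def dpSGD (grad : X → Params m c d → Params m c d) (r : Selection c) (γ C σ η : ℝ) (B : ℕ)
    (D : Multiset X) : (T : ℕ) → Params m c d → Measure (Fin T → Params m c d)
  | 0, _ => Measure.dirac Fin.elim0
  | T + 1, θ =>
    (poissonSubsample γ (noisyGradient grad r C σ B θ) D).bind fun G =>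
      (dpSGD grad r γ C σ η B D T (θ - η • G)).map fun g => Fin.cons G g

/-- DP-FEST: select the buckets, draw the initial parameters from `init`, and run DP-SGD on the
selected buckets. The output is the whole transcript: the selected buckets, the initial
parameters and all the noisy gradients. The per-example gradient may depend on the selection
(the model that is trained may use the selected buckets only). -/
def dpFEST (bucket : (j : Fin p) → X → Option (Fin (c j))) (k : Fin p → ℕ) (b : Fin p → ℝ)
    (init : Measure (Params m c d)) (grad : Selection c → X → Params m c d → Params m c d)
    (γ C σ η : ℝ) (B T : ℕ) (D : Multiset X) :
    Measure (Selection c × Params m c d × (Fin T → Params m c d)) :=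
  (selectBuckets bucket k b D).bind fun r =>
    init.bind fun θ =>
      (dpSGD (grad r) r γ C σ η B D T θ).map fun g => (r, θ, g)

/-- The selected buckets together with the trained parameters `θ_T = θ_0 - η (G_1 + ⋯ + G_T)`,
as a function of the transcript. -/
def trainedModel (η : ℝ) {T : ℕ} (o : Selection c × Params m c d × (Fin T → Params m c d)) :
    Selection c × Params m c d :=
  (o.1, o.2.1 - η • ∑ t, o.2.2 t)

end DPFest

end

/-!
The proof separates the two stages.

*Bucket selection.* The top-`k` set `R` survives raising the noise of its own members and lowering
the other entries (`topK_eq_of_le`), also up to a shift common to all entries. Adding an example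
raises one count by `1`; removing one is, up to a shift, raising all the other counts by `1`. In
both cases the event that `R` is selected on one dataset is carried into the same event on the
other dataset by adding `1` to the noise of the at most `k` members of `R`, and an upward shift of
a Gumbel variable by `1` costs a factor of at most `e ^ (1 / b)` (`gumbel_map_add_le`). Hence the
law of the selection on `D` is at most `e ^ (k / b)` times that on `D'`, and these factors multiply
over the features (`selectBuckets_le`).

*DP-SGD.* Fix the selection and the initial parameters, and let `x` be the example by which the
datasets differ. A step with or without `x` has the law of one and the same random map `κ θ`,
applied to a sample `y` of `pairP γ σ` or of `pairQ σ`: `κ θ y` draws a batch from the common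
examples, adds `y` times the clipped gradient `u` of `x`, and adds Gaussian noise whose covariance
is the desired one minus the part already supplied by the noise in `y`
(`map_residual_eq`, `subsampledGradient_eq_bind`, `subsampledGradient_cons_eq_bind`). That
covariance is positive semidefinite because `‖u‖ ≤ C`. By independence the `T`-step transcript is
then a random function of a sample of the `T`-fold product (`dpSGD_eq_bind`), the same function for
both datasets, so that the hockey-stick bound carries over to it (`bind_le_of_hockeyStick_le`).

*Composition.* The bound for DP-SGD is integrated against the law of the selection on `D`. The
additive error `δ` is multiplied by the total mass of that law only, and the remaining term is
compared with the law of the selection on `D'` at the cost of `e ^ ε₁`. The trained model is a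
measurable function of the transcript.
-/

noncomputable section

namespace DPFest

/-! ### Product measures -/

theorem pi_mono {ι : Type*} [Fintype ι] {α : ι → Type*} [∀ i, MeasurableSpace (α i)]
    {μ ν : ∀ i, Measure (α i)} (h : ∀ i, μ i ≤ ν i) : Measure.pi μ ≤ Measure.pi ν := by
  refine Measure.le_iff.2 fun S hS => ?_
  rw [Measure.pi, Measure.pi, toMeasure_apply _ _ hS, toMeasure_apply _ _ hS]
  refine OuterMeasure.le_pi.2 (fun s _ => ?_) S
  exact (OuterMeasure.pi_pi_le _ s).trans (Finset.prod_le_prod' fun i _ => h i (s i))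

theorem pi_le_prod_smul {ι : Type*} [Fintype ι] {α : ι → Type*} [∀ i, MeasurableSpace (α i)]
    {μ ν : ∀ i, Measure (α i)} [∀ i, IsFiniteMeasure (ν i)] {a : ι → ℝ}
    (h : ∀ i, μ i ≤ ENNReal.ofReal (a i) • ν i) :
    Measure.pi μ ≤ (∏ i, ENNReal.ofReal (a i)) • Measure.pi ν := by
  have : ∀ i, IsFiniteMeasure (ENNReal.ofReal (a i) • ν i) := fun i =>
    Measure.smul_finite (ν i) ENNReal.ofReal_ne_top
  refine (pi_mono h).trans (le_of_eq (Measure.pi_eq fun s _ => ?_))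
  simp [Measure.pi_pi, Finset.prod_mul_distrib]

theorem measure_le_of_singleton {α : Type*} [Finite α] [MeasurableSpace α]
    [MeasurableSingletonClass α] {μ ν : Measure α} (h : ∀ a, μ {a} ≤ ν {a}) : μ ≤ ν := by
  have := Fintype.ofFinite α
  classical
  refine Measure.le_iff.2 fun S _ => ?_
  rw [← Set.coe_toFinset S, ← sum_measure_singleton, ← sum_measure_singleton]
  exact Finset.sum_le_sum fun a _ => h a

/-! ### The Gumbel distribution -/

theorem measurable_gumbelDensity (b : ℝ) : Measurable fun x : ℝ =>
    ENNReal.ofReal (b⁻¹ * Real.exp (-(x / b + Real.exp (-(x / b))))) := by fun_prop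

theorem gumbel_univ_le_one {b : ℝ} (hb : 0 < b) : gumbel b Set.univ ≤ 1 := by
  have hderiv : ∀ x : ℝ, HasDerivAt (fun x => Real.exp (-Real.exp (-(x / b))))
      (b⁻¹ * Real.exp (-(x / b + Real.exp (-(x / b))))) x := by
    intro x
    have h1 : HasDerivAt (fun x : ℝ => -(x / b)) (-(1 / b)) x :=
      ((hasDerivAt_id x).div_const b).neg
    have h2 : HasDerivAt (fun x : ℝ => -Real.exp (-(x / b)))
        (-(Real.exp (-(x / b)) * -(1 / b))) x := h1.exp.neg
    refine h2.exp.congr_deriv ?_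
    rw [neg_add, Real.exp_add]
    ring
  have hmono : MonotoneOn (fun x : ℝ => Real.exp (-Real.exp (-(x / b)))) Set.univ := by
    intro x _ y _ hxy
    have : x / b ≤ y / b := by gcongr
    simpa using this
  have h := lintegral_deriv_eq_volume_image_of_monotoneOn MeasurableSet.univ
    (fun x _ => (hderiv x).hasDerivWithinAt) hmono
  rw [gumbel, withDensity_apply _ MeasurableSet.univ, h]
  calc volume _ ≤ volume (Set.Icc (0 : ℝ) 1) := by
        refine measure_mono ?_
        rintro _ ⟨x, -, rfl⟩
        exact ⟨(Real.exp_pos _).le, by simp [Real.exp_nonneg]⟩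
    _ = 1 := by simp

theorem isFiniteMeasure_gumbel {b : ℝ} (hb : 0 < b) : IsFiniteMeasure (gumbel b) :=
  ⟨(gumbel_univ_le_one hb).trans_lt ENNReal.one_lt_top⟩

/-- Shifting Gumbel noise upwards by `t ≥ 0` raises the probability of an event by a factor of at
most `e ^ (t / b)`: the quotient of the densities is
`exp (t / b - e ^ (-x / b) * (e ^ (t / b) - 1))`. Downward shifts admit no such bound. -/
theorem gumbel_map_add_le {b t : ℝ} (hb : 0 < b) (ht : 0 ≤ t) :
    (gumbel b).map (· + t) ≤ ENNReal.ofReal (Real.exp (t / b)) • gumbel b := by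
  have hm : Measurable (fun x : ℝ => x + t) := by fun_prop
  refine Measure.le_iff.2 fun S hS => ?_
  rw [Measure.map_apply hm hS, Measure.smul_apply, gumbel, withDensity_apply _ (hm hS),
    withDensity_apply _ hS, ← lintegral_indicator (hm hS), ← lintegral_indicator hS,
    smul_eq_mul, ← lintegral_const_mul _ ((measurable_gumbelDensity b).indicator hS),
    ← lintegral_sub_right_eq_self _ t]
  refine lintegral_mono fun x => ?_
  by_cases hx : x ∈ S
  · have hx' : x - t ∈ (fun x => x + t) ⁻¹' S := by simpa using hx
    simp only [Set.indicator_of_mem hx, Set.indicator_of_mem hx']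
    rw [← ENNReal.ofReal_mul (Real.exp_nonneg _)]
    refine ENNReal.ofReal_le_ofReal ?_
    rw [mul_left_comm, ← Real.exp_add]
    have h1 : -(x / b) ≤ -((x - t) / b) := by
      have : (x - t) / b ≤ x / b := by gcongr; linarith
      linarith
    have h2 := Real.exp_le_exp.2 h1
    have h3 : (x - t) / b = x / b - t / b := sub_div _ _ _
    gcongr
    linarith
  · have hx' : x - t ∉ (fun x => x + t) ⁻¹' S := by simpa using hx
    simp [Set.indicator_of_notMem hx, Set.indicator_of_notMem hx']

/-! ### One-shot top-`k` selection -/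

/-- The sort key of an index: larger entries first, and smaller indices first among equal
entries, so that `topK` selects the indices with fewer than `k` larger keys. -/
def sortKey {c : ℕ} (v : Fin c → ℝ) (i : Fin c) : ℝ ×ₗ (Fin c)ᵒᵈ :=
  toLex (v i, OrderDual.toDual i)

theorem sortKey_injective {c : ℕ} (v : Fin c → ℝ) : Function.Injective (sortKey v) := by
  intro i j h
  simpa [sortKey] using congrArg (fun q => OrderDual.ofDual (ofLex q).2) h

theorem sortKey_lt_iff {c : ℕ} (v : Fin c → ℝ) (i j : Fin c) :
    sortKey v i < sortKey v j ↔ v i < v j ∨ (v i = v j ∧ j < i) := by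
  simp [sortKey, Prod.Lex.toLex_lt_toLex]

theorem mem_topK_iff {c : ℕ} (k : ℕ) (v : Fin c → ℝ) (i : Fin c) :
    i ∈ topK k v ↔ Set.ncard {j | sortKey v i < sortKey v j} < k := by
  simp only [sortKey_lt_iff]; rfl

theorem ncard_topK_le {c : ℕ} (k : ℕ) (v : Fin c → ℝ) : (topK k v).ncard ≤ k := by
  rcases (topK k v).eq_empty_or_nonempty with h | h
  · simp [h]
  -- The selected index with the smallest key is beaten by all the others.
  obtain ⟨i, hi, hmin⟩ := Set.exists_min_image _ (sortKey v) (Set.toFinite _) h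
  have hsub : topK k v \ {i} ⊆ {j | sortKey v i < sortKey v j} := fun j hj =>
    lt_of_le_of_ne (hmin j hj.1) fun h => hj.2 (sortKey_injective v h).symm
  have h1 := Set.ncard_le_ncard hsub (Set.toFinite _)
  have h2 := Set.ncard_sdiff_singleton_add_one hi (Set.toFinite _)
  have h3 := (mem_topK_iff k v i).1 hi
  omega

theorem le_ncard_topK {c : ℕ} {k : ℕ} {v : Fin c → ℝ} {i : Fin c} (hi : i ∉ topK k v) :
    k ≤ (topK k v).ncard := by
  -- Only selected indices beat the unselected index with the largest key.
  obtain ⟨j, hj, hmax⟩ := Set.exists_max_image (topK k v)ᶜ (sortKey v) (Set.toFinite _) ⟨i, hi⟩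
  have h1 := (mem_topK_iff k v j).not.1 hj
  refine (not_lt.1 h1).trans (Set.ncard_le_ncard (fun l hl => ?_) (Set.toFinite _))
  by_contra hl'
  exact absurd (hmax l hl') (not_le.2 hl)

theorem sortKey_lt_of_mem_topK {c : ℕ} {k : ℕ} {v : Fin c → ℝ} {i j : Fin c}
    (hi : i ∈ topK k v) (hj : j ∉ topK k v) : sortKey v j < sortKey v i := by
  by_contra! h
  refine hj ((mem_topK_iff k v j).2 (lt_of_le_of_lt ?_ ((mem_topK_iff k v i).1 hi)))
  exact Set.ncard_le_ncard (fun l hl => lt_of_le_of_lt h hl) (Set.toFinite _)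

/-- The selected set is unchanged when, up to a common shift `s`, the selected entries are raised
and the other entries are lowered. -/
theorem topK_eq_of_le {c : ℕ} {k : ℕ} {v w : Fin c → ℝ} (s : ℝ)
    (hmem : ∀ i ∈ topK k v, v i + s ≤ w i) (hnot : ∀ j ∉ topK k v, w j ≤ v j + s) :
    topK k w = topK k v := by
  have hlt : ∀ i ∈ topK k v, ∀ j ∉ topK k v, sortKey w j < sortKey w i := by
    intro i hi j hj
    have h := (sortKey_lt_iff v j i).1 (sortKey_lt_of_mem_topK hi hj)
    have h1 := hmem i hi
    have h2 := hnot j hj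
    rw [sortKey_lt_iff]
    rcases h with h | ⟨h, hij⟩
    · left; linarith
    · rcases (show w j ≤ w i by linarith).lt_or_eq with h' | h'
      exacts [Or.inl h', Or.inr ⟨h', hij⟩]
  ext i
  rw [mem_topK_iff]
  by_cases hi : i ∈ topK k v
  · refine iff_of_true ?_ hi
    have hsub : {j | sortKey w i < sortKey w j} ⊆ topK k v \ {i} := by
      intro j hj
      refine ⟨?_, ?_⟩
      · by_contra hj'
        exact lt_asymm hj (hlt i hi j hj')
      · rintro rfl
        exact lt_irrefl (sortKey w j) hj
    have h1 := Set.ncard_le_ncard hsub (Set.toFinite _)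
    have h2 := Set.ncard_sdiff_singleton_add_one hi (Set.toFinite _)
    have h3 := ncard_topK_le k v
    omega
  · refine iff_of_false (not_lt.2 ((le_ncard_topK hi).trans ?_)) hi
    exact Set.ncard_le_ncard (fun j hj => hlt j hj i hi) (Set.toFinite _)

theorem measurable_topK {c : ℕ} (k : ℕ) : Measurable (topK k : (Fin c → ℝ) → Set (Fin c)) := by
  rw [measurable_set_iff]
  intro i
  have hB : Measurable fun v : Fin c → ℝ => {j | v i < v j ∨ (v i = v j ∧ j < i)} := by
    rw [measurable_set_iff]
    intro j
    refine measurableSet_setOfPred.1 (MeasurableSet.union ?_ (MeasurableSet.inter ?_ ?_))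
    · exact measurableSet_lt (measurable_pi_apply i) (measurable_pi_apply j)
    · exact measurableSet_eq_fun (measurable_pi_apply i) (measurable_pi_apply j)
    · exact MeasurableSet.const _
  exact (measurable_of_countable fun B : Set (Fin c) => B.ncard < k).comp hB

variable {X : Type*}

theorem measurable_topK_add {c : ℕ} (k : ℕ) (v : Fin c → ℝ) :
    Measurable fun z : Fin c → ℝ => topK k fun i => v i + z i :=
  (measurable_topK k).comp (by fun_prop)

/-- If `v + s` lies between `w` and `w + 1` in every entry, then noisy top-`k` selection from `v`
has at most `e ^ (k / b)` times the probability of noisy top-`k` selection from `w`: adding `1` to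
the noise of the selected entries, of which there are at most `k`, leads from the selection of a
set on `v` to the selection of the same set on `w`. -/
theorem pi_gumbel_map_topK_le {c k : ℕ} {b : ℝ} (hb : 0 < b) {v w : Fin c → ℝ} (s : ℝ)
    (h1 : ∀ i, v i + s ≤ w i + 1) (h2 : ∀ i, w i ≤ v i + s) :
    (Measure.pi fun _ : Fin c => gumbel b).map (fun z => topK k fun i => v i + z i) ≤
      ENNReal.ofReal (Real.exp (k / b)) •
        (Measure.pi fun _ : Fin c => gumbel b).map fun z => topK k fun i => w i + z i := by
  classical
  have := isFiniteMeasure_gumbel hb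
  refine measure_le_of_singleton fun R => ?_
  have hv := measurable_topK_add k v
  have hw := measurable_topK_add k w
  have hR : MeasurableSet ({R} : Set (Set (Fin c))) := measurableSet_singleton R
  rw [Measure.smul_apply, Measure.map_apply hv hR, Measure.map_apply hw hR]
  -- A set of more than `k` indices is never selected.
  by_cases hk : R.ncard ≤ k
  swap
  · have hempty : (fun z : Fin c → ℝ => topK k fun i => v i + z i) ⁻¹' {R} = ∅ := by
      refine Set.eq_empty_of_forall_notMem fun z hz => hk ?_
      rw [← show topK k (fun i => v i + z i) = R from hz]
      exact ncard_topK_le _ _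
    rw [hempty, measure_empty]
    exact zero_le
  let t : Fin c → ℝ := fun i => if i ∈ R then 1 else 0
  have ht : ∀ i, 0 ≤ t i := fun i => by dsimp only [t]; split_ifs <;> norm_num
  have hmap : (Measure.pi fun _ : Fin c => gumbel b).map (fun z i => z i + t i) ≤
      ENNReal.ofReal (Real.exp (k / b)) • Measure.pi fun _ : Fin c => gumbel b := by
    rw [Measure.pi_map_pi fun i => (measurable_add_const (t i)).aemeasurable]
    refine (pi_le_prod_smul fun i => gumbel_map_add_le hb (ht i)).trans ?_
    rw [← ENNReal.ofReal_prod_of_nonneg fun i _ => Real.exp_nonneg _, ← Real.exp_sum]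
    refine Measure.le_iff.2 fun S _ => ?_
    rw [Measure.smul_apply, Measure.smul_apply, smul_eq_mul, smul_eq_mul]
    gcongr
    rw [← Finset.sum_div]
    gcongr
    have : ∑ i, t i = (R.ncard : ℝ) := by
      simp [t, Set.ncard_eq_toFinset_card']
    rw [this]
    exact_mod_cast hk
  have hadd : Measurable fun (z : Fin c → ℝ) i => z i + t i := by fun_prop
  refine le_trans ?_ (hmap ((fun z => topK k fun i => w i + z i) ⁻¹' {R}))
  rw [Measure.map_apply hadd (hw hR)]
  refine measure_mono fun z hz => ?_
  have hz : topK k (fun i => v i + z i) = R := hz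
  have key : topK k (fun i => w i + (z i + t i)) = topK k (fun i => v i + z i) := by
    refine topK_eq_of_le s (fun i hi => ?_) fun j hj => ?_
    · rw [hz] at hi
      simp only [t, hi, if_true]
      linarith [h1 i]
    · rw [hz] at hj
      simp only [t, hj, if_false]
      linarith [h2 j]
  exact key.trans hz

theorem bucketCount_cons_bounds {c : ℕ} (bucket : X → Option (Fin c)) (x : X) (D : Multiset X)
    (i : Fin c) : (bucketCount bucket D i : ℝ) ≤ bucketCount bucket (x ::ₘ D) i ∧
      (bucketCount bucket (x ::ₘ D) i : ℝ) ≤ bucketCount bucket D i + 1 := by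
  classical
  simp only [bucketCount, Multiset.map_cons, Multiset.count_cons]
  split_ifs <;> constructor <;> push_cast <;> linarith

theorem gumbelTopK_le {c : ℕ} (bucket : X → Option (Fin c)) (k : ℕ) {b : ℝ} (hb : 0 < b)
    {D D' : Multiset X} (h : Adjacent D D') :
    gumbelTopK bucket k b D ≤ ENNReal.ofReal (Real.exp (k / b)) • gumbelTopK bucket k b D' := by
  rcases h with ⟨x, rfl⟩ | ⟨x, rfl⟩
  · refine pi_gumbel_map_topK_le hb 0 (fun i => ?_) fun i => ?_ <;>
      linarith [bucketCount_cons_bounds bucket x D' i]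
  · -- Removing an example is adding `1` to the counts of all the other buckets, up to a shift.
    refine pi_gumbel_map_topK_le hb 1 (fun i => ?_) fun i => ?_ <;>
      linarith [bucketCount_cons_bounds bucket x D i]

theorem gumbelTopK_univ_le_one {c : ℕ} (bucket : X → Option (Fin c)) (k : ℕ) {b : ℝ} (hb : 0 < b)
    (D : Multiset X) : gumbelTopK bucket k b D Set.univ ≤ 1 := by
  have := isFiniteMeasure_gumbel hb
  rw [gumbelTopK, Measure.map_apply (measurable_topK_add k _) MeasurableSet.univ,
    Set.preimage_univ, Measure.pi_univ]
  exact Finset.prod_le_one' fun _ _ => gumbel_univ_le_one hb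

theorem isFiniteMeasure_gumbelTopK {c : ℕ} (bucket : X → Option (Fin c)) (k : ℕ) {b : ℝ}
    (hb : 0 < b) (D : Multiset X) : IsFiniteMeasure (gumbelTopK bucket k b D) :=
  ⟨(gumbelTopK_univ_le_one bucket k hb D).trans_lt ENNReal.one_lt_top⟩

theorem selectBuckets_univ_le_one {p : ℕ} {c : Fin p → ℕ}
    (bucket : (j : Fin p) → X → Option (Fin (c j))) (k : Fin p → ℕ) {b : Fin p → ℝ}
    (hb : ∀ j, 0 < b j) (D : Multiset X) : selectBuckets bucket k b D Set.univ ≤ 1 := by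
  have := fun j => isFiniteMeasure_gumbelTopK (bucket j) (k j) (hb j) D
  rw [selectBuckets, Measure.pi_univ]
  exact Finset.prod_le_one' fun j _ => gumbelTopK_univ_le_one (bucket j) (k j) (hb j) D

theorem selectBuckets_le {p : ℕ} {c : Fin p → ℕ}
    (bucket : (j : Fin p) → X → Option (Fin (c j))) (k : Fin p → ℕ) {b : Fin p → ℝ}
    (hb : ∀ j, 0 < b j) {ε₁ : ℝ} (hε₁ : ∑ j, (k j : ℝ) / b j ≤ ε₁) {D D' : Multiset X}
    (h : Adjacent D D') :
    selectBuckets bucket k b D ≤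
      ENNReal.ofReal (Real.exp ε₁) • selectBuckets bucket k b D' := by
  have := fun j => isFiniteMeasure_gumbelTopK (bucket j) (k j) (hb j) D'
  refine (pi_le_prod_smul fun j => gumbelTopK_le (bucket j) (k j) (hb j) h).trans ?_
  rw [← ENNReal.ofReal_prod_of_nonneg fun i _ => Real.exp_nonneg _, ← Real.exp_sum]
  refine Measure.le_iff.2 fun S _ => ?_
  rw [Measure.smul_apply, Measure.smul_apply, smul_eq_mul, smul_eq_mul]
  gcongr
  rfl

/-! ### The hockey-stick divergence and test functions -/

theorem measure_le_of_hockeyStick_le {Ω : Type*} [MeasurableSpace Ω] {P Q : Measure Ω}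
    [IsFiniteMeasure P] [IsFiniteMeasure Q] {ε δ : ℝ} (h : hockeyStick ε P Q ≤ δ) {S : Set Ω}
    (hS : MeasurableSet S) :
    P S ≤ ENNReal.ofReal (Real.exp ε) * Q S + ENNReal.ofReal δ := by
  have hbdd : BddAbove (Set.range fun S : {S : Set Ω // MeasurableSet S} =>
      P.real S.1 - Real.exp ε * Q.real S.1) := by
    refine ⟨P.real Set.univ, ?_⟩
    rintro _ ⟨S, rfl⟩
    have h1 : P.real S.1 ≤ P.real Set.univ := measureReal_mono (Set.subset_univ _)
    have h2 : 0 ≤ Real.exp ε * Q.real S.1 := by positivity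
    dsimp only
    linarith
  have h1 : P.real S - Real.exp ε * Q.real S ≤ δ := (le_ciSup hbdd ⟨S, hS⟩).trans h
  rw [← ofReal_measureReal (μ := P) (s := S), ← ofReal_measureReal (μ := Q) (s := S),
    ← ENNReal.ofReal_mul (Real.exp_nonneg _)]
  exact (ENNReal.ofReal_le_ofReal (by linarith)).trans ENNReal.ofReal_add_le

/-- A bound for all events extends to test functions with values in `[0, 1]`, by integrating
it over the superlevel sets. -/
theorem lintegral_le_of_measure_le {Ω : Type*} [MeasurableSpace Ω] {P Q : Measure Ω}
    {a e : ℝ≥0∞} (h : ∀ S, MeasurableSet S → P S ≤ a * Q S + e) {f : Ω → ℝ≥0∞}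
    (hf : Measurable f) (hf1 : ∀ x, f x ≤ 1) :
    ∫⁻ x, f x ∂P ≤ a * ∫⁻ x, f x ∂Q + e := by
  have layer : ∀ μ : Measure Ω,
      ∫⁻ x, f x ∂μ = ∫⁻ t in Set.Ioc (0 : ℝ) 1, μ {x | t ≤ (f x).toReal} := by
    intro μ
    have h1 : ∫⁻ x, f x ∂μ = ∫⁻ x, ENNReal.ofReal (f x).toReal ∂μ :=
      lintegral_congr fun x =>
        (ENNReal.ofReal_toReal (ne_top_of_le_ne_top ENNReal.one_ne_top (hf1 x))).symm
    rw [h1, lintegral_eq_lintegral_meas_le μ (ae_of_all _ fun x => ENNReal.toReal_nonneg)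
      hf.ennreal_toReal.aemeasurable]
    have hzero : ∫⁻ t in Set.Ioi (1 : ℝ), μ {x | t ≤ (f x).toReal} = 0 := by
      refine (setLIntegral_congr_fun measurableSet_Ioi fun t ht => ?_).trans lintegral_zero
      have hempty : {x | t ≤ (f x).toReal} = ∅ := by
        refine Set.eq_empty_of_forall_notMem fun x hx =>
          not_le.2 (Set.mem_Ioi.1 ht) (le_trans hx ?_)
        exact ENNReal.toReal_le_of_le_ofReal zero_le_one (by simpa using hf1 x)
      simp [hempty]
    rw [← Set.Ioc_union_Ioi_eq_Ioi (zero_le_one' ℝ),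
      lintegral_union measurableSet_Ioi (Set.Ioc_disjoint_Ioi le_rfl), hzero, add_zero]
  have hanti : Measurable fun t : ℝ => Q {x | t ≤ (f x).toReal} := by
    refine Antitone.measurable fun s t hst => measure_mono fun x hx => ?_
    exact le_trans hst hx
  rw [layer P, layer Q, ← lintegral_const_mul _ hanti]
  calc ∫⁻ t in Set.Ioc (0 : ℝ) 1, P {x | t ≤ (f x).toReal}
      ≤ ∫⁻ t in Set.Ioc (0 : ℝ) 1, (a * Q {x | t ≤ (f x).toReal} + e) :=
        lintegral_mono fun t => h _ (measurableSet_le measurable_const hf.ennreal_toReal)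
    _ = _ := by
        rw [lintegral_add_right _ measurable_const]
        simp

/-! ### Measurability of kernels -/

theorem measurable_map_of_measurable_uncurry {α β Ω : Type*} [MeasurableSpace α]
    [MeasurableSpace β] [MeasurableSpace Ω] (μ : Measure Ω) [SFinite μ] {h : α → Ω → β}
    (hh : Measurable (Function.uncurry h)) : Measurable fun a => μ.map (h a) := by
  refine Measure.measurable_of_measurable_coe _ fun S hS => ?_
  have : (fun a => μ.map (h a) S) = fun a => μ (Prod.mk a ⁻¹' (Function.uncurry h ⁻¹' S)) := by
    ext a
    have ha : Measurable (h a) := hh.comp measurable_prodMk_left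
    rw [Measure.map_apply ha hS]
    rfl
  rw [this]
  exact measurable_measure_prodMk_left (hh hS)

theorem measurable_bind_of_measurable_uncurry {α β Ω : Type*} [MeasurableSpace α]
    [MeasurableSpace β] [MeasurableSpace Ω] {μ : α → Measure β} (hμ : Measurable μ)
    [∀ a, IsProbabilityMeasure (μ a)] {h : α → β → Measure Ω}
    (hh : Measurable (Function.uncurry h)) : Measurable fun a => (μ a).bind (h a) := by
  refine Measure.measurable_of_measurable_coe _ fun S hS => ?_
  have hha : ∀ a, Measurable (h a) := fun a => hh.comp measurable_prodMk_left
  have : (fun a => (μ a).bind (h a) S) = fun a => ∫⁻ b, h a b S ∂(μ a) := by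
    ext a
    rw [Measure.bind_apply hS (hha a).aemeasurable]
  rw [this]
  let κ : Kernel α β := ⟨μ, hμ⟩
  have : IsMarkovKernel κ := ⟨fun a => inferInstanceAs (IsProbabilityMeasure (μ a))⟩
  exact Measurable.lintegral_kernel_prod_right (κ := κ)
    (f := fun a b => h a b S) ((Measure.measurable_coe hS).comp hh)

theorem bind_map_eq_prod_map {α β Ω : Type*} [MeasurableSpace α]
    [MeasurableSpace β] [MeasurableSpace Ω] (ν : Measure α) (μ : Measure Ω) [SFinite μ]
    {h : α → Ω → β} (hh : Measurable (Function.uncurry h)) :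
    (ν.bind fun a => μ.map (h a)) = (ν.prod μ).map (Function.uncurry h) := by
  ext S hS
  rw [Measure.bind_apply hS (measurable_map_of_measurable_uncurry μ hh).aemeasurable,
    Measure.map_apply hh hS, Measure.prod_apply (hh hS)]
  refine lintegral_congr fun a => ?_
  have ha : Measurable (h a) := hh.comp measurable_prodMk_left
  rw [Measure.map_apply ha hS]
  rfl

theorem isProbabilityMeasure_bind {α β : Type*} [MeasurableSpace α] [MeasurableSpace β]
    {μ : Measure α} [IsProbabilityMeasure μ] {h : α → Measure β} (hh : Measurable h)
    [∀ a, IsProbabilityMeasure (h a)] : IsProbabilityMeasure (μ.bind h) :=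
  ⟨by simp [Measure.bind_apply MeasurableSet.univ hh.aemeasurable]⟩

/-! ### Poisson subsampling -/

theorem multiset_sum_measure_apply {α Ω : Type*} [MeasurableSpace Ω] (s : Multiset α)
    (μ : α → Measure Ω) (S : Set Ω) :
    (s.map μ).sum S = (s.map fun a => μ a S).sum := by
  induction s using Multiset.induction_on with
  | empty => simp
  | cons a s ih => simp [ih]

theorem measurable_multiset_sum {ι α Ω : Type*} [MeasurableSpace α] [MeasurableSpace Ω]
    (s : Multiset ι) {μ : ι → α → Measure Ω} (hμ : ∀ i, Measurable (μ i)) :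
    Measurable fun a => (s.map fun i => μ i a).sum := by
  induction s using Multiset.induction_on with
  | empty => simp [measurable_const]
  | cons i s ih =>
    simp only [Multiset.map_cons, Multiset.sum_cons]
    exact (hμ i).add ih

theorem measurable_poissonSubsample {α Ω : Type*} [MeasurableSpace α] [MeasurableSpace Ω] (γ : ℝ)
    {f : α → Multiset X → Measure Ω} (hf : ∀ A, Measurable fun a => f a A) (D : Multiset X) :
    Measurable fun a => poissonSubsample γ (f a) D := by
  refine measurable_multiset_sum D.powerset
    (μ := fun A a => ENNReal.ofReal (γ ^ A.card * (1 - γ) ^ (D.card - A.card)) • f a A) fun A => ?_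
  refine Measure.measurable_of_measurable_coe _ fun S hS => ?_
  exact ((Measure.measurable_coe hS).comp (hf A)).const_mul _

/-- The batch of a dataset with one more example contains that example with probability `γ`, and
is otherwise distributed as before. -/
theorem poissonSubsample_cons {Ω : Type*} [MeasurableSpace Ω] {γ : ℝ} (hγ : 0 ≤ γ) (hγ1 : γ ≤ 1)
    (f : Multiset X → Measure Ω) (x : X) (D : Multiset X) :
    poissonSubsample γ f (x ::ₘ D) = poissonSubsample γ
      (fun A => ENNReal.ofReal (1 - γ) • f A + ENNReal.ofReal γ • f (x ::ₘ A)) D := by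
  have h0 : 0 ≤ 1 - γ := by linarith
  simp only [poissonSubsample, Multiset.powerset_cons, Multiset.map_add, Multiset.sum_add,
    Multiset.map_map, Function.comp_def, smul_add, smul_smul, Multiset.sum_map_add,
    Multiset.card_cons]
  congr 1
  · refine congrArg _ (Multiset.map_congr rfl fun A hA => ?_)
    have := Multiset.card_le_card (Multiset.mem_powerset.1 hA)
    rw [← ENNReal.ofReal_mul (by positivity), mul_assoc, ← pow_succ, Nat.sub_add_comm this]
  · refine congrArg _ (Multiset.map_congr rfl fun A hA => ?_)
    rw [← ENNReal.ofReal_mul (by positivity), Nat.add_sub_add_right, pow_succ]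
    congr 2
    ring

theorem poissonSubsample_univ {Ω : Type*} [MeasurableSpace Ω] {γ : ℝ} (hγ : 0 ≤ γ) (hγ1 : γ ≤ 1)
    (D : Multiset X) (f : Multiset X → Measure Ω) [∀ A, IsProbabilityMeasure (f A)] :
    poissonSubsample γ f D Set.univ = 1 := by
  have h0 : 0 ≤ 1 - γ := by linarith
  have hf : poissonSubsample γ f D Set.univ =
      poissonSubsample γ (fun _ => Measure.dirac ()) D Set.univ := by
    simp [poissonSubsample, multiset_sum_measure_apply]
  rw [hf]
  clear hf
  induction D using Multiset.induction_on with
  | empty => simp [poissonSubsample]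
  | cons x D ih =>
    rw [poissonSubsample_cons hγ hγ1, ← ih]
    simp only [← add_smul, ← ENNReal.ofReal_add h0 hγ, sub_add_cancel, ENNReal.ofReal_one, one_smul]

theorem isProbabilityMeasure_poissonSubsample {Ω : Type*} [MeasurableSpace Ω] {γ : ℝ} (hγ : 0 ≤ γ)
    (hγ1 : γ ≤ 1) (D : Multiset X) (f : Multiset X → Measure Ω)
    [∀ A, IsProbabilityMeasure (f A)] : IsProbabilityMeasure (poissonSubsample γ f D) :=
  ⟨poissonSubsample_univ hγ hγ1 D f⟩

theorem bind_poissonSubsample {α Ω : Type*} [MeasurableSpace α] [MeasurableSpace Ω] (γ : ℝ)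
    (ν : Measure α) {f : α → Multiset X → Measure Ω} (hf : ∀ A, Measurable fun a => f a A)
    (D : Multiset X) : (ν.bind fun a => poissonSubsample γ (f a) D) =
      poissonSubsample γ (fun A => ν.bind fun a => f a A) D := by
  ext S hS
  rw [Measure.bind_apply hS (measurable_poissonSubsample γ hf D).aemeasurable]
  simp only [poissonSubsample, multiset_sum_measure_apply, Measure.smul_apply, smul_eq_mul]
  have hm : ∀ A, Measurable fun a => f a A S := fun A => (Measure.measurable_coe hS).comp (hf A)
  simp only [Measure.bind_apply hS (hf _).aemeasurable]
  induction D.powerset using Multiset.induction_on with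
  | empty => simp
  | cons A s ih =>
    simp only [Multiset.map_cons, Multiset.sum_cons]
    rw [lintegral_add_left ((hm A).const_mul _), ih, lintegral_const_mul _ (hm A)]

/-! ### A Gaussian with a one-dimensional component split off -/

section Gaussian

open scoped RealInnerProductSpace

variable {E : Type*} [NormedAddCommGroup E] [InnerProductSpace ℝ E]

/-- For a projection `π` that fixes `u`, and `‖u‖ ≤ C`, the symmetric square root
`π - κ ⟪u, ·⟫ u` of `π - C⁻² ⟪u, ·⟫ u`; here `κ = 1 / (C (C + √(C² - ‖u‖²)))` is a root of
`2 κ - κ² ‖u‖² = C⁻²`. -/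
def residual (π : E →ₗ[ℝ] E) (C : ℝ) (u z : E) : E :=
  π z - ((C * (C + √(C ^ 2 - ‖u‖ ^ 2)))⁻¹ * ⟪u, z⟫) • u

theorem inner_residual_left {π : E →ₗ[ℝ] E} (hπ : π.IsSymmetric) (C : ℝ) (u z t : E) :
    ⟪residual π C u z, t⟫ = ⟪z, residual π C u t⟫ := by
  simp only [residual, inner_sub_left, inner_sub_right, real_inner_smul_left,
    real_inner_smul_right, hπ z t, real_inner_comm u z]
  ring

theorem norm_residual_sq {π : E →ₗ[ℝ] E} (hπ : π.IsSymmetric) {C : ℝ} (hC : 0 < C) {u : E}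
    (hu : π u = u) (huC : ‖u‖ ≤ C) (t : E) :
    ‖residual π C u t‖ ^ 2 = ‖π t‖ ^ 2 - (⟪u, t⟫ / C) ^ 2 := by
  have h1 : ⟪π t, u⟫ = ⟪u, t⟫ := by rw [hπ t u, hu, real_inner_comm]
  rw [residual, norm_sub_sq_real, real_inner_smul_right, h1, norm_smul, mul_pow,
    Real.norm_eq_abs, sq_abs]
  have hq0 := Real.sqrt_nonneg (C ^ 2 - ‖u‖ ^ 2)
  have hq : √(C ^ 2 - ‖u‖ ^ 2) ^ 2 = C ^ 2 - ‖u‖ ^ 2 :=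
    Real.sq_sqrt (by nlinarith [norm_nonneg u])
  set q := √(C ^ 2 - ‖u‖ ^ 2)
  have hu2 : ‖u‖ ^ 2 = C ^ 2 - q ^ 2 := by linarith
  rw [hu2]
  have : C + q ≠ 0 := by positivity
  field_simp
  ring

variable [FiniteDimensional ℝ E]

theorem continuous_residual (π : E →ₗ[ℝ] E) (C : ℝ) (u : E) : Continuous (residual π C u) := by
  have := π.continuous_of_finiteDimensional
  unfold residual
  fun_prop

variable [MeasurableSpace E] [BorelSpace E]

/-- Gaussian noise with covariance `σ² C² π` around `a + μ u`, where `‖u‖ ≤ C`, is obtained from a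
sample `y` of `N(μ, σ²)` as `a + y u` plus independent Gaussian noise whose law does not depend
on `μ`. -/
theorem map_residual_eq {π : E →ₗ[ℝ] E} (hπ : π.IsSymmetric) {C σ : ℝ} (hC : 0 < C)
    {u : E} (hu : π u = u) (huC : ‖u‖ ≤ C) (a : E) (μ : ℝ) :
    ((gaussianReal μ (Real.toNNReal (σ ^ 2))).prod (stdGaussian E)).map
        (fun q => a + q.1 • u + (σ * C) • residual π C u q.2) =
      (stdGaussian E).map fun z => a + μ • u + (σ * C) • π z := by
  have hπc := π.continuous_of_finiteDimensional
  have hres := continuous_residual π C u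
  refine Measure.ext_of_charFun ?_
  ext t
  rw [charFun_apply, charFun_apply, integral_map (by fun_prop)
    (Continuous.aestronglyMeasurable (by fun_prop)), integral_map (by fun_prop)
    (Continuous.aestronglyMeasurable (by fun_prop))]
  have hl : ∀ q : ℝ × E, Complex.exp (⟪a + q.1 • u + (σ * C) • residual π C u q.2, t⟫ *
      Complex.I) = Complex.exp (⟪a, t⟫ * Complex.I) * (Complex.exp (⟪u, t⟫ * q.1 * Complex.I) *
        Complex.exp (⟪q.2, (σ * C) • residual π C u t⟫ * Complex.I)) := by
    intro q
    rw [← Complex.exp_add, ← Complex.exp_add]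
    congr 1
    simp only [inner_add_left, real_inner_smul_left, real_inner_smul_right,
      inner_residual_left hπ]
    push_cast
    ring
  have hr : ∀ z : E, Complex.exp (⟪a + μ • u + (σ * C) • π z, t⟫ * Complex.I) =
      Complex.exp (⟪a + μ • u, t⟫ * Complex.I) *
        Complex.exp (⟪z, (σ * C) • π t⟫ * Complex.I) := by
    intro z
    rw [← Complex.exp_add]
    congr 1
    simp only [inner_add_left, real_inner_smul_left, real_inner_smul_right, hπ z t]
    push_cast
    ring
  simp_rw [hl, hr]
  rw [integral_const_mul, integral_const_mul,
    integral_prod_mul (fun y : ℝ => Complex.exp (⟪u, t⟫ * y * Complex.I))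
      (fun z : E => Complex.exp (⟪z, (σ * C) • residual π C u t⟫ * Complex.I)),
    ← charFun_apply_real, ← charFun_apply, ← charFun_apply, charFun_stdGaussian,
    charFun_stdGaussian, charFun_gaussianReal, ← Complex.exp_add, ← Complex.exp_add,
    ← Complex.exp_add]
  congr 1
  have hn : ∀ v : E, ((‖(σ * C) • v‖ : ℝ) : ℂ) ^ 2 = ((σ * C) ^ 2 * ‖v‖ ^ 2 : ℝ) := by
    intro v
    rw [← Complex.ofReal_pow, norm_smul, mul_pow, Real.norm_eq_abs, sq_abs]
  rw [hn, hn, norm_residual_sq hπ hC hu huC, Real.coe_toNNReal _ (sq_nonneg σ)]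
  have hC' : (C : ℂ) ≠ 0 := by exact_mod_cast hC.ne'
  simp only [inner_add_left, real_inner_smul_left]
  push_cast
  field_simp
  ring

end Gaussian

/-! ### One step of DP-SGD -/

variable {m p : ℕ} {c d : Fin p → ℕ}

/-- `mask r` as a linear map. -/
def maskₗ (r : Selection c) : Params m c d →ₗ[ℝ] Params m c d where
  toFun := mask r
  map_add' v w := by
    ext (i | q)
    · simp [mask]
    · by_cases h : q.2.1 ∈ r q.1 <;> simp [mask, h]
  map_smul' a v := by
    ext (i | q)
    · simp [mask]
    · by_cases h : q.2.1 ∈ r q.1 <;> simp [mask, h]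

theorem maskₗ_apply (r : Selection c) (v : Params m c d) : maskₗ r v = mask r v := rfl

theorem mask_mask (r : Selection c) (v : Params m c d) : mask r (mask r v) = mask r v := by
  ext (i | q)
  · simp [mask]
  · by_cases h : q.2.1 ∈ r q.1 <;> simp [mask, h]

theorem isSymmetric_maskₗ (r : Selection c) :
    (maskₗ r : Params m c d →ₗ[ℝ] Params m c d).IsSymmetric := by
  intro v w
  rw [PiLp.inner_apply, PiLp.inner_apply]
  refine Finset.sum_congr rfl ?_
  rintro (i | q) -
  · simp [maskₗ_apply, mask]
  · by_cases h : q.2.1 ∈ r q.1 <;> simp [maskₗ_apply, mask, h]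

theorem continuous_mask (r : Selection c) :
    Continuous (mask r : Params m c d → Params m c d) :=
  (maskₗ r).continuous_of_finiteDimensional

theorem mask_clip_mask (r : Selection c) (C : ℝ) (v : Params m c d) :
    mask r (clip C (mask r v)) = clip C (mask r v) := by
  rw [clip, ← maskₗ_apply r (_ • _), map_smul, maskₗ_apply, mask_mask]

theorem norm_clip_le {C : ℝ} (hC : 0 < C) (v : Params m c d) : ‖clip C v‖ ≤ C := by
  have h1 : 0 < max 1 (‖v‖ / C) := lt_max_of_lt_left one_pos
  rw [clip, norm_smul, norm_inv, Real.norm_of_nonneg h1.le, inv_mul_le_iff₀ h1, ← div_le_iff₀ hC]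
  exact le_max_right _ _

theorem measurable_clip (C : ℝ) : Measurable (clip C : Params m c d → Params m c d) := by
  unfold clip
  fun_prop

/-- The clipped gradient of the example `x`. -/
def clippedGrad (grad : X → Params m c d → Params m c d) (r : Selection c) (C : ℝ) (x : X)
    (θ : Params m c d) : Params m c d :=
  clip C (mask r (grad x θ))

theorem measurable_clippedGrad {grad : X → Params m c d → Params m c d}
    (hgrad : ∀ x, Measurable (grad x)) (r : Selection c) (C : ℝ) (x : X) :
    Measurable (clippedGrad grad r C x) :=
  (measurable_clip C).comp ((continuous_mask r).measurable.comp (hgrad x))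

theorem measurable_sum_clippedGrad {grad : X → Params m c d → Params m c d}
    (hgrad : ∀ x, Measurable (grad x)) (r : Selection c) (C : ℝ) (A : Multiset X) :
    Measurable fun θ => (A.map fun x => clippedGrad grad r C x θ).sum := by
  induction A using Multiset.induction_on with
  | empty => simp [measurable_const]
  | cons x A ih =>
    simp only [Multiset.map_cons, Multiset.sum_cons]
    exact (measurable_clippedGrad hgrad r C x).add ih

/-- The clipped gradients of the batch `A` at `θ` plus `y` times that of `x`, with Gaussian noise
whose covariance is reduced by the rank-one part that an `N(μ, σ²)`-distributed `y` supplies. For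
`μ = 0` and `μ = 1` and such a random `y`, this is the noisy gradient of the batch `A` and of the
batch `x ::ₘ A`, respectively. -/
def coupledGradient (grad : X → Params m c d → Params m c d) (r : Selection c) (C σ : ℝ) (B : ℕ)
    (x : X) (A : Multiset X) (θ : Params m c d) (y : ℝ) : Measure (Params m c d) :=
  (stdGaussian (Params m c d)).map fun z =>
    (B : ℝ)⁻¹ • ((A.map fun x => clippedGrad grad r C x θ).sum + y • clippedGrad grad r C x θ +
      (σ * C) • residual (maskₗ r) C (clippedGrad grad r C x θ) z)

theorem measurable_uncurry_coupledGradient {grad : X → Params m c d → Params m c d}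
    (hgrad : ∀ x, Measurable (grad x)) (r : Selection c) (C σ : ℝ) (B : ℕ) (x : X)
    (A : Multiset X) :
    Measurable (Function.uncurry (coupledGradient grad r C σ B x A)) := by
  have h1 := measurable_sum_clippedGrad hgrad r C A
  have h2 := measurable_clippedGrad hgrad r C x
  have h3 : Measurable (maskₗ r : Params m c d → Params m c d) := (continuous_mask r).measurable
  have hθ : Measurable fun q : (Params m c d × ℝ) × Params m c d => q.1.1 := by fun_prop
  have h1' := h1.comp hθ
  have h2' := h2.comp hθ
  have h3' : Measurable fun q : (Params m c d × ℝ) × Params m c d => maskₗ r q.2 :=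
    h3.comp measurable_snd
  have hκ : Measurable fun v : Params m c d => (C * (C + √(C ^ 2 - ‖v‖ ^ 2)))⁻¹ := by fun_prop
  refine measurable_map_of_measurable_uncurry _ ?_
  refine ((h1'.add (measurable_fst.snd.smul h2')).add
    ((h3'.sub (((hκ.comp h2').mul (h2'.inner measurable_snd)).smul h2')).const_smul
      (σ * C))).const_smul (B : ℝ)⁻¹

theorem measurable_coupledGradient {grad : X → Params m c d → Params m c d}
    (hgrad : ∀ x, Measurable (grad x)) (r : Selection c) (C σ : ℝ) (B : ℕ) (x : X)
    (A : Multiset X) (θ : Params m c d) : Measurable (coupledGradient grad r C σ B x A θ) :=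
  (measurable_uncurry_coupledGradient hgrad r C σ B x A).of_uncurry_left

theorem isProbabilityMeasure_coupledGradient (grad : X → Params m c d → Params m c d)
    (r : Selection c) (C σ : ℝ) (B : ℕ) (x : X) (A : Multiset X) (θ : Params m c d) (y : ℝ) :
    IsProbabilityMeasure (coupledGradient grad r C σ B x A θ y) := by
  have h := continuous_residual (maskₗ r) C (clippedGrad grad r C x θ)
  exact Measure.isProbabilityMeasure_map (by fun_prop)

theorem gaussianReal_bind_coupledGradient (grad : X → Params m c d → Params m c d)
    (r : Selection c) {C : ℝ} (hC : 0 < C) (σ : ℝ) (B : ℕ)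
    (x : X) (A : Multiset X) (θ : Params m c d) (μ : ℝ) :
    (gaussianReal μ (Real.toNNReal (σ ^ 2))).bind (coupledGradient grad r C σ B x A θ) =
      (stdGaussian (Params m c d)).map fun z =>
        (B : ℝ)⁻¹ • ((A.map fun x => clippedGrad grad r C x θ).sum +
          μ • clippedGrad grad r C x θ + (σ * C) • mask r z) := by
  set u := clippedGrad grad r C x θ with hu
  have hres := continuous_residual (maskₗ r) C u
  have hmask := continuous_mask (m := m) (d := d) r
  have hmaskₗ : Continuous (maskₗ r : Params m c d → Params m c d) := continuous_mask r
  have h := congrArg (Measure.map fun v => (B : ℝ)⁻¹ • v)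
    (map_residual_eq (isSymmetric_maskₗ r) (σ := σ) hC (u := u)
      (mask_clip_mask r C (grad x θ)) (norm_clip_le hC _)
      (A.map fun x => clippedGrad grad r C x θ).sum μ)
  rw [Measure.map_map (by fun_prop) (by fun_prop), Measure.map_map (by fun_prop) (by fun_prop)] at h
  refine Eq.trans (bind_map_eq_prod_map _ _ ?_) h
  unfold Function.uncurry
  fun_prop

theorem noisyGradient_eq (grad : X → Params m c d → Params m c d) (r : Selection c) (C σ : ℝ)
    (B : ℕ) (θ : Params m c d) (A : Multiset X) : noisyGradient grad r C σ B θ A =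
      (stdGaussian (Params m c d)).map fun z =>
        (B : ℝ)⁻¹ • ((A.map fun x => clippedGrad grad r C x θ).sum + (σ * C) • mask r z) :=
  rfl

theorem isProbabilityMeasure_noisyGradient (grad : X → Params m c d → Params m c d)
    (r : Selection c) (C σ : ℝ) (B : ℕ) (θ : Params m c d) (A : Multiset X) :
    IsProbabilityMeasure (noisyGradient grad r C σ B θ A) := by
  have h := continuous_mask (m := m) (d := d) r
  rw [noisyGradient_eq]
  exact Measure.isProbabilityMeasure_map (by fun_prop)

theorem measurable_noisyGradient {grad : X → Params m c d → Params m c d}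
    (hgrad : ∀ x, Measurable (grad x)) (r : Selection c) (C σ : ℝ) (B : ℕ) (A : Multiset X) :
    Measurable fun θ => noisyGradient grad r C σ B θ A := by
  have h1 := measurable_sum_clippedGrad hgrad r C A
  have h := continuous_mask (m := m) (d := d) r
  simp only [noisyGradient_eq]
  refine measurable_map_of_measurable_uncurry _ ?_
  exact ((h1.comp measurable_fst).add
    ((h.measurable.comp measurable_snd).const_smul (σ * C))).const_smul (B : ℝ)⁻¹

/-- The law of the noisy gradient of a Poisson-subsampled batch. -/
def subsampledGradient (grad : X → Params m c d → Params m c d) (r : Selection c) (γ C σ : ℝ)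
    (B : ℕ) (D : Multiset X) (θ : Params m c d) : Measure (Params m c d) :=
  poissonSubsample γ (noisyGradient grad r C σ B θ) D

/-- The random map that turns a sample `y` of one member of the pair `pairP γ σ`, `pairQ σ` into
the noisy gradient of a step of DP-SGD with or without the example `x`. -/
def coupledStep (grad : X → Params m c d → Params m c d) (r : Selection c) (γ C σ : ℝ) (B : ℕ)
    (x : X) (D : Multiset X) (θ : Params m c d) (y : ℝ) : Measure (Params m c d) :=
  poissonSubsample γ (fun A => coupledGradient grad r C σ B x A θ y) D

theorem isProbabilityMeasure_subsampledGradient (grad : X → Params m c d → Params m c d)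
    (r : Selection c) {γ : ℝ} (hγ : 0 ≤ γ) (hγ1 : γ ≤ 1) (C σ : ℝ) (B : ℕ) (D : Multiset X)
    (θ : Params m c d) : IsProbabilityMeasure (subsampledGradient grad r γ C σ B D θ) := by
  have := isProbabilityMeasure_noisyGradient grad r C σ B θ
  exact isProbabilityMeasure_poissonSubsample hγ hγ1 D _

theorem measurable_subsampledGradient {grad : X → Params m c d → Params m c d}
    (hgrad : ∀ x, Measurable (grad x)) (r : Selection c) (γ C σ : ℝ) (B : ℕ) (D : Multiset X) :
    Measurable (subsampledGradient grad r γ C σ B D) :=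
  measurable_poissonSubsample γ (measurable_noisyGradient hgrad r C σ B) D

theorem isProbabilityMeasure_coupledStep (grad : X → Params m c d → Params m c d)
    (r : Selection c) {γ : ℝ} (hγ : 0 ≤ γ) (hγ1 : γ ≤ 1) (C σ : ℝ) (B : ℕ) (x : X)
    (D : Multiset X) (θ : Params m c d) (y : ℝ) :
    IsProbabilityMeasure (coupledStep grad r γ C σ B x D θ y) := by
  have := fun A => isProbabilityMeasure_coupledGradient grad r C σ B x A θ y
  exact isProbabilityMeasure_poissonSubsample hγ hγ1 D _

theorem measurable_coupledStep {grad : X → Params m c d → Params m c d}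
    (hgrad : ∀ x, Measurable (grad x)) (r : Selection c) (γ C σ : ℝ) (B : ℕ) (x : X)
    (D : Multiset X) :
    Measurable (Function.uncurry (coupledStep grad r γ C σ B x D)) :=
  measurable_poissonSubsample γ (measurable_uncurry_coupledGradient hgrad r C σ B x) D

theorem subsampledGradient_eq_bind {grad : X → Params m c d → Params m c d}
    (hgrad : ∀ x, Measurable (grad x)) (r : Selection c) (γ : ℝ) {C : ℝ} (hC : 0 < C) (σ : ℝ)
    (B : ℕ) (x : X) (D : Multiset X) (θ : Params m c d) :
    subsampledGradient grad r γ C σ B D θ =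
      (pairQ σ).bind (coupledStep grad r γ C σ B x D θ) := by
  unfold coupledStep pairQ
  rw [bind_poissonSubsample γ _
    (f := fun y A => coupledGradient grad r C σ B x A θ y)
    (fun A => measurable_coupledGradient hgrad r C σ B x A θ)]
  simp only [gaussianReal_bind_coupledGradient grad r hC, zero_smul, add_zero]
  rfl

theorem subsampledGradient_cons_eq_bind {grad : X → Params m c d → Params m c d}
    (hgrad : ∀ x, Measurable (grad x)) (r : Selection c) {γ : ℝ} (hγ : 0 ≤ γ) (hγ1 : γ ≤ 1)
    {C : ℝ} (hC : 0 < C) (σ : ℝ) (B : ℕ) (x : X) (D : Multiset X) (θ : Params m c d) :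
    subsampledGradient grad r γ C σ B (x ::ₘ D) θ =
      (pairP γ σ).bind (coupledStep grad r γ C σ B x D θ) := by
  unfold coupledStep
  rw [subsampledGradient, poissonSubsample_cons hγ hγ1, bind_poissonSubsample γ _
    (f := fun y A => coupledGradient grad r C σ B x A θ y)
    (fun A => measurable_coupledGradient hgrad r C σ B x A θ)]
  congr 1
  ext1 A
  have hm : Measurable (coupledGradient grad r C σ B x A θ) :=
    measurable_coupledGradient hgrad r C σ B x A θ
  have hadd : ∀ μ ν : Measure ℝ, (μ + ν).bind (coupledGradient grad r C σ B x A θ) =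
      μ.bind (coupledGradient grad r C σ B x A θ) +
        ν.bind (coupledGradient grad r C σ B x A θ) := by
    intro μ ν
    ext S hS
    simp only [Measure.bind_apply hS hm.aemeasurable, Measure.add_apply, lintegral_add_measure]
  rw [pairP, hadd, Measure.bind_smul, Measure.bind_smul,
    gaussianReal_bind_coupledGradient grad r hC, gaussianReal_bind_coupledGradient grad r hC]
  simp only [zero_smul, add_zero, one_smul, noisyGradient_eq, Multiset.map_cons, Multiset.sum_cons]
  simp only [add_comm (clippedGrad grad r C x θ)]

/-! ### Adaptive composition -/

theorem measurable_finCons {E : Type*} [MeasurableSpace E] (T : ℕ) :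
    Measurable fun q : E × (Fin T → E) => (Fin.cons q.1 q.2 : Fin (T + 1) → E) := by
  refine measurable_pi_lambda _ fun i => ?_
  refine Fin.cases ?_ (fun j => ?_) i
  · exact measurable_fst
  · exact (measurable_pi_apply j).comp measurable_snd

theorem measurable_map_finCons {E α : Type*} [MeasurableSpace E] [MeasurableSpace α] {T : ℕ}
    {G : α → E} (hG : Measurable G) {μ : α → Measure (Fin T → E)} (hμ : Measurable μ)
    [∀ a, IsProbabilityMeasure (μ a)] :
    Measurable fun a => (μ a).map fun g => (Fin.cons (G a) g : Fin (T + 1) → E) := by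
  have h : ∀ a, (μ a).map (fun g => (Fin.cons (G a) g : Fin (T + 1) → E)) =
      (μ a).bind fun g => Measure.dirac (Fin.cons (G a) g) := fun a =>
    (Measure.bind_dirac_eq_map _ ((measurable_finCons T).comp measurable_prodMk_left)).symm
  simp only [h]
  refine measurable_bind_of_measurable_uncurry hμ ?_
  exact Measure.measurable_dirac.comp
    ((measurable_finCons T).comp ((hG.comp measurable_fst).prodMk measurable_snd))

/-- The transcript obtained from samples `y 0, …, y (T - 1)` by applying the random map
`κ θ (y t)` at each step, `θ` being updated as in `dpSGD`. -/
def coupledTranscript {E : Type*} [MeasurableSpace E] [AddCommGroup E] [Module ℝ E] (η : ℝ)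
    (κ : E → ℝ → Measure E) : (T : ℕ) → E → (Fin T → ℝ) → Measure (Fin T → E)
  | 0, _, _ => Measure.dirac Fin.elim0
  | T + 1, θ, y => (κ θ (y 0)).bind fun G =>
      (coupledTranscript η κ T (θ - η • G) (Fin.tail y)).map fun g => Fin.cons G g

theorem coupledTranscript_spec {κ : Params m c d → ℝ → Measure (Params m c d)}
    (hκ : Measurable (Function.uncurry κ)) [hκp : ∀ θ y, IsProbabilityMeasure (κ θ y)] (η : ℝ)
    (T : ℕ) : Measurable (Function.uncurry (coupledTranscript η κ T)) ∧
      ∀ θ y, IsProbabilityMeasure (coupledTranscript η κ T θ y) := by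
  induction T with
  | zero => exact ⟨measurable_const, fun θ y => Measure.dirac.isProbabilityMeasure⟩
  | succ T ih =>
    obtain ⟨ih1, ih2⟩ := ih
    have hcons : ∀ G : Params m c d, Measurable fun g : Fin T → Params m c d =>
        (Fin.cons G g : Fin (T + 1) → Params m c d) := fun G =>
      (measurable_finCons T).comp measurable_prodMk_left
    have htail : Measurable (Fin.tail : (Fin (T + 1) → ℝ) → Fin T → ℝ) :=
      measurable_pi_lambda _ fun i => measurable_pi_apply _
    have hstep : Measurable fun q : (Params m c d × (Fin (T + 1) → ℝ)) × Params m c d =>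
        (coupledTranscript η κ T (q.1.1 - η • q.2) (Fin.tail q.1.2)).map
          fun g => (Fin.cons q.2 g : Fin (T + 1) → Params m c d) := by
      refine measurable_map_finCons measurable_snd (ih1.comp (Measurable.prodMk ?_ ?_))
      · fun_prop
      · exact htail.comp measurable_fst.snd
    refine ⟨?_, fun θ y => ?_⟩
    · have : ∀ q : Params m c d × (Fin (T + 1) → ℝ), IsProbabilityMeasure (κ q.1 (q.2 0)) :=
        fun q => hκp _ _
      exact measurable_bind_of_measurable_uncurry
        (μ := fun q : Params m c d × (Fin (T + 1) → ℝ) => κ q.1 (q.2 0))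
        (hκ.comp (measurable_fst.prodMk ((measurable_pi_apply 0).comp measurable_snd))) hstep
    · have : ∀ G, IsProbabilityMeasure ((coupledTranscript η κ T (θ - η • G) (Fin.tail y)).map
          fun g => (Fin.cons G g : Fin (T + 1) → Params m c d)) := fun G =>
        Measure.isProbabilityMeasure_map (hcons G).aemeasurable
      exact isProbabilityMeasure_bind (hstep.comp (measurable_prodMk_left (x := (θ, y))))

theorem dpSGD_spec {grad : X → Params m c d → Params m c d} (hgrad : ∀ x, Measurable (grad x))
    (r : Selection c) {γ : ℝ} (hγ : 0 ≤ γ) (hγ1 : γ ≤ 1) (C σ η : ℝ) (B : ℕ) (D : Multiset X)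
    (T : ℕ) : Measurable (dpSGD grad r γ C σ η B D T) ∧
      ∀ θ, IsProbabilityMeasure (dpSGD grad r γ C σ η B D T θ) := by
  -- DP-SGD is the coupled transcript for a random map that ignores the samples.
  have hp := isProbabilityMeasure_subsampledGradient grad r hγ hγ1 C σ B D
  obtain ⟨h1, h2⟩ := coupledTranscript_spec
    (κ := fun θ _ => subsampledGradient grad r γ C σ B D θ) (hκp := fun θ _ => hp θ)
    ((measurable_subsampledGradient hgrad r γ C σ B D).comp measurable_fst) η T
  have h : ∀ θ y, dpSGD grad r γ C σ η B D T θ =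
      coupledTranscript η (fun θ _ => subsampledGradient grad r γ C σ B D θ) T θ y := by
    clear h1 h2
    induction T with
    | zero => exact fun θ y => rfl
    | succ T ih =>
      intro θ y
      simp only [dpSGD, coupledTranscript, ← ih]
      rfl
  have h' : dpSGD grad r γ C σ η B D T = fun θ =>
      coupledTranscript η (fun θ _ => subsampledGradient grad r γ C σ B D θ) T θ 0 :=
    funext fun θ => h θ 0
  refine ⟨?_, fun θ => ?_⟩
  · rw [h']
    exact h1.comp measurable_prodMk_right
  · rw [h']
    exact h2 θ 0

theorem lintegral_power_succ {ν : Measure ℝ} [IsProbabilityMeasure ν] (T : ℕ)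
    {f : (Fin (T + 1) → ℝ) → ℝ≥0∞} (hf : Measurable f) :
    ∫⁻ y, f y ∂(power ν (T + 1)) = ∫⁻ a, ∫⁻ y, f (Fin.cons a y) ∂(power ν T) ∂ν := by
  have h := (measurePreserving_piFinSuccAbove (fun _ : Fin (T + 1) => ν) 0).symm
  have h' := h.lintegral_comp hf
  rw [power, ← h', lintegral_prod _ (by fun_prop)]
  simp only [MeasurableEquiv.piFinSuccAbove_symm_apply, Fin.insertNthEquiv_zero]
  rfl

/-- If each step of DP-SGD is a random function `κ` of a sample of `ν`, then the transcript is a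
random function of a sample of `ν × ⋯ × ν`, and this function depends on `κ` only. -/
theorem dpSGD_eq_bind {grad : X → Params m c d → Params m c d} (hgrad : ∀ x, Measurable (grad x))
    (r : Selection c) {γ : ℝ} (hγ : 0 ≤ γ) (hγ1 : γ ≤ 1) (C σ η : ℝ) (B : ℕ) (D : Multiset X)
    {ν : Measure ℝ} [IsProbabilityMeasure ν] {κ : Params m c d → ℝ → Measure (Params m c d)}
    (hκ : Measurable (Function.uncurry κ)) [hκp : ∀ θ y, IsProbabilityMeasure (κ θ y)]
    (hstep : ∀ θ, subsampledGradient grad r γ C σ B D θ = ν.bind (κ θ)) (T : ℕ)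
    (θ : Params m c d) :
    dpSGD grad r γ C σ η B D T θ = (power ν T).bind (coupledTranscript η κ T θ) := by
  have hpow : ∀ T, IsProbabilityMeasure (power ν T) := fun T => by unfold power; infer_instance
  have hκθ : ∀ θ, Measurable (κ θ) := fun θ => hκ.of_uncurry_left
  induction T generalizing θ with
  | zero =>
    change Measure.dirac _ = (power ν 0).bind fun _ => Measure.dirac _
    simp [Measure.bind_const]
  | succ T ih =>
    ext S hS
    have hcons : ∀ G : Params m c d, Measurable fun g : Fin T → Params m c d =>
        (Fin.cons G g : Fin (T + 1) → Params m c d) := fun G =>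
      (measurable_finCons T).comp measurable_prodMk_left
    obtain ⟨hK, hKp⟩ := coupledTranscript_spec hκ η T
    obtain ⟨hK', -⟩ := coupledTranscript_spec hκ η (T + 1)
    obtain ⟨hM, hMp⟩ := dpSGD_spec hgrad r hγ hγ1 C σ η B D T
    have hK'θ : Measurable (coupledTranscript η κ (T + 1) θ) := hK'.of_uncurry_left
    have hnext : Measurable fun G => (dpSGD grad r γ C σ η B D T (θ - η • G)).map
        fun g => (Fin.cons G g : Fin (T + 1) → Params m c d) :=
      measurable_map_finCons measurable_id (hM.comp (by fun_prop))
    have hKnext : Measurable fun q : (Fin T → ℝ) × Params m c d =>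
        (coupledTranscript η κ T (θ - η • q.2) q.1).map
          fun g => (Fin.cons q.2 g : Fin (T + 1) → Params m c d) := by
      refine measurable_map_finCons measurable_snd (hK.comp (Measurable.prodMk ?_ ?_)) <;> fun_prop
    have hinner : ∀ G, (dpSGD grad r γ C σ η B D T (θ - η • G)).map
          (fun g => (Fin.cons G g : Fin (T + 1) → Params m c d)) S =
        ∫⁻ y, (coupledTranscript η κ T (θ - η • G) y).map
          (fun g => (Fin.cons G g : Fin (T + 1) → Params m c d)) S ∂(power ν T) := by
      intro G
      have hKG : Measurable (coupledTranscript η κ T (θ - η • G)) := hK.of_uncurry_left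
      rw [Measure.map_apply (hcons G) hS, ih,
        Measure.bind_apply (hcons G hS) hKG.aemeasurable]
      exact lintegral_congr fun y => (Measure.map_apply (hcons G) hS).symm
    have hmeas : Measurable fun G => (dpSGD grad r γ C σ η B D T (θ - η • G)).map
          (fun g => (Fin.cons G g : Fin (T + 1) → Params m c d)) S :=
      (Measure.measurable_coe hS).comp hnext
    change (subsampledGradient grad r γ C σ B D θ).bind _ S = _
    rw [Measure.bind_apply hS hnext.aemeasurable, hstep,
      Measure.lintegral_bind (hκθ θ).aemeasurable hmeas.aemeasurable,
      Measure.bind_apply hS hK'θ.aemeasurable,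
      lintegral_power_succ T (f := fun y => coupledTranscript η κ (T + 1) θ y S)
        ((Measure.measurable_coe hS).comp hK'θ)]
    refine lintegral_congr fun a => ?_
    simp only [hinner]
    -- The update and the remaining samples are independent.
    have hswap : Measurable (Function.uncurry fun G y =>
        (coupledTranscript η κ T (θ - η • G) y).map
          (fun g => (Fin.cons G g : Fin (T + 1) → Params m c d)) S) :=
      (Measure.measurable_coe hS).comp (hKnext.comp measurable_swap)
    rw [lintegral_lintegral_swap hswap.aemeasurable]
    refine lintegral_congr fun y => ?_
    have hKy : Measurable fun G => (coupledTranscript η κ T (θ - η • G) y).map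
        fun g => (Fin.cons G g : Fin (T + 1) → Params m c d) :=
      hKnext.comp measurable_prodMk_left
    simp only [coupledTranscript, Fin.cons_zero, Fin.tail_cons]
    rw [Measure.bind_apply hS hKy.aemeasurable]

/-! ### Privacy of DP-SGD and of DP-FEST -/

instance isProbabilityMeasure_pairQ (σ : ℝ) : IsProbabilityMeasure (pairQ σ) := by
  unfold pairQ; infer_instance

theorem isProbabilityMeasure_pairP {γ : ℝ} (hγ : 0 ≤ γ) (hγ1 : γ ≤ 1) (σ : ℝ) :
    IsProbabilityMeasure (pairP γ σ) := by
  refine ⟨?_⟩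
  have h0 : 0 ≤ 1 - γ := by linarith
  simp [pairP, ← ENNReal.ofReal_add h0 hγ]

theorem bind_le_of_hockeyStick_le {α Ω : Type*} [MeasurableSpace α] [MeasurableSpace Ω]
    {P Q : Measure α} [IsFiniteMeasure P] [IsFiniteMeasure Q] {ε δ : ℝ}
    (h : hockeyStick ε P Q ≤ δ) {K : α → Measure Ω} (hK : Measurable K)
    [∀ a, IsProbabilityMeasure (K a)] {S : Set Ω} (hS : MeasurableSet S) :
    P.bind K S ≤ ENNReal.ofReal (Real.exp ε) * Q.bind K S + ENNReal.ofReal δ := by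
  rw [Measure.bind_apply hS hK.aemeasurable, Measure.bind_apply hS hK.aemeasurable]
  exact lintegral_le_of_measure_le (fun U hU => measure_le_of_hockeyStick_le h hU)
    ((Measure.measurable_coe hS).comp hK) fun a => prob_le_one

theorem dpSGD_le {grad : X → Params m c d → Params m c d} (hgrad : ∀ x, Measurable (grad x))
    (r : Selection c) {γ C σ : ℝ} (η : ℝ) (hγ : 0 ≤ γ) (hγ1 : γ ≤ 1) (hC : 0 < C) (B T : ℕ)
    {ε δ : ℝ} (hPQ : hockeyStick ε (power (pairP γ σ) T) (power (pairQ σ) T) ≤ δ)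
    (hQP : hockeyStick ε (power (pairQ σ) T) (power (pairP γ σ) T) ≤ δ) {D D' : Multiset X}
    (h : Adjacent D D') (θ : Params m c d) {S : Set (Fin T → Params m c d)}
    (hS : MeasurableSet S) :
    dpSGD grad r γ C σ η B D T θ S ≤
      ENNReal.ofReal (Real.exp ε) * dpSGD grad r γ C σ η B D' T θ S + ENNReal.ofReal δ := by
  have hP := isProbabilityMeasure_pairP hγ hγ1 σ
  have hPT : IsProbabilityMeasure (power (pairP γ σ) T) := by unfold power; infer_instance
  have hQT : IsProbabilityMeasure (power (pairQ σ) T) := by unfold power; infer_instance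
  have main : ∀ (x : X) (D : Multiset X), ∃ K : (Fin T → ℝ) → Measure (Fin T → Params m c d),
      Measurable K ∧ (∀ y, IsProbabilityMeasure (K y)) ∧
      dpSGD grad r γ C σ η B D T θ = (power (pairQ σ) T).bind K ∧
      dpSGD grad r γ C σ η B (x ::ₘ D) T θ = (power (pairP γ σ) T).bind K := by
    intro x D
    have hκ := measurable_coupledStep hgrad r γ C σ B x D
    have hκp := isProbabilityMeasure_coupledStep grad r hγ hγ1 C σ B x D
    obtain ⟨hK, hKp⟩ := coupledTranscript_spec hκ η T
    refine ⟨coupledTranscript η (coupledStep grad r γ C σ B x D) T θ,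
      hK.of_uncurry_left, hKp θ, ?_, ?_⟩
    · exact dpSGD_eq_bind hgrad r hγ hγ1 C σ η B D hκ
        (subsampledGradient_eq_bind hgrad r γ hC σ B x D) T θ
    · exact dpSGD_eq_bind hgrad r hγ hγ1 C σ η B (x ::ₘ D) hκ
        (subsampledGradient_cons_eq_bind hgrad r hγ hγ1 hC σ B x D) T θ
  rcases h with ⟨x, rfl⟩ | ⟨x, rfl⟩
  · obtain ⟨K, hK, hKp, h1, h2⟩ := main x D'
    rw [h1, h2]
    exact bind_le_of_hockeyStick_le hPQ hK hS
  · obtain ⟨K, hK, hKp, h1, h2⟩ := main x D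
    rw [h1, h2]
    exact bind_le_of_hockeyStick_le hQP hK hS

/-- DP-FEST is DP-SGD on the selected buckets, integrated over the selection and the initial
parameters. -/
theorem dpFEST_apply (bucket : (j : Fin p) → X → Option (Fin (c j))) (k : Fin p → ℕ)
    (b : Fin p → ℝ) (init : Measure (Params m c d)) [IsProbabilityMeasure init]
    {grad : Selection c → X → Params m c d → Params m c d} (hgrad : ∀ r x, Measurable (grad r x))
    {γ : ℝ} (hγ : 0 ≤ γ) (hγ1 : γ ≤ 1) (C σ η : ℝ) (B T : ℕ) (D : Multiset X)
    {S : Set (Selection c × Params m c d × (Fin T → Params m c d))} (hS : MeasurableSet S) :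
    dpFEST bucket k b init grad γ C σ η B T D S =
      ∫⁻ r, ∫⁻ θ, dpSGD (grad r) r γ C σ η B D T θ {g | (r, θ, g) ∈ S} ∂init
        ∂(selectBuckets bucket k b D) := by
  rw [dpFEST, Measure.bind_apply hS (measurable_of_countable _).aemeasurable]
  refine lintegral_congr fun r => ?_
  obtain ⟨hM, hMp⟩ := dpSGD_spec (hgrad r) r hγ hγ1 C σ η B D T
  have hpair : ∀ θ : Params m c d, Measurable fun g : Fin T → Params m c d => (r, θ, g) := fun θ =>
    measurable_const.prodMk (measurable_const.prodMk measurable_id)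
  have h : ∀ θ, (dpSGD (grad r) r γ C σ η B D T θ).map (fun g => (r, θ, g)) =
      (dpSGD (grad r) r γ C σ η B D T θ).bind fun g => Measure.dirac (r, θ, g) := fun θ =>
    (Measure.bind_dirac_eq_map _ (hpair θ)).symm
  have hmeas : Measurable fun θ =>
      (dpSGD (grad r) r γ C σ η B D T θ).map fun g => (r, θ, g) := by
    simp only [h]
    refine measurable_bind_of_measurable_uncurry hM ?_
    exact Measure.measurable_dirac.comp (by fun_prop)
  rw [Measure.bind_apply hS hmeas.aemeasurable]
  exact lintegral_congr fun θ => Measure.map_apply (hpair θ) hS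

theorem measurable_trainedModel (η : ℝ) (T : ℕ) : Measurable (trainedModel η :
    Selection c × Params m c d × (Fin T → Params m c d) → Selection c × Params m c d) := by
  unfold trainedModel
  fun_prop

end DPFest

end

theorem mainTheorem2 {X : Type*} {m p : ℕ} (c d : Fin p → ℕ)
    (bucket : (j : Fin p) → X → Option (Fin (c j)))
    (k : Fin p → ℕ) (b : Fin p → ℝ) (hb : ∀ j, 0 < b j)
    (init : Measure (DPFest.Params m c d)) [IsProbabilityMeasure init]
    (grad : DPFest.Selection c → X → DPFest.Params m c d → DPFest.Params m c d)
    (hgrad : ∀ r x, Measurable (grad r x))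
    (γ C σ η : ℝ) (hγ : 0 < γ) (hγ1 : γ ≤ 1) (hC : 0 < C) (hσ : 0 < σ)
    (B T : ℕ) (hB : 0 < B)
    (ε ε₁ δ : ℝ) (hε₁ : ∑ j, (k j : ℝ) / b j ≤ ε₁)
    (hPQ : DPFest.hockeyStick (ε - ε₁) (DPFest.power (DPFest.pairP γ σ) T)
      (DPFest.power (DPFest.pairQ σ) T) ≤ δ)
    (hQP : DPFest.hockeyStick (ε - ε₁) (DPFest.power (DPFest.pairQ σ) T)
      (DPFest.power (DPFest.pairP γ σ) T) ≤ δ) :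
    DPFest.IsDP (DPFest.selectBuckets bucket k b) ε₁ 0 ∧
    DPFest.IsDP (DPFest.dpFEST bucket k b init grad γ C σ η B T) ε δ ∧
    DPFest.IsDP (fun D => (DPFest.dpFEST bucket k b init grad γ C σ η B T D).map
      (DPFest.trainedModel η)) ε δ := by
  have htranscript : DPFest.IsDP (DPFest.dpFEST bucket k b init grad γ C σ η B T) ε δ := by
    intro D D' h S hS
    rw [DPFest.dpFEST_apply bucket k b init hgrad hγ.le hγ1 C σ η B T D hS,
      DPFest.dpFEST_apply bucket k b init hgrad hγ.le hγ1 C σ η B T D' hS]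
    set e := ENNReal.ofReal (Real.exp (ε - ε₁)) with he
    have hstep : ∀ r : DPFest.Selection c,
        ∫⁻ θ, DPFest.dpSGD (grad r) r γ C σ η B D T θ {g | (r, θ, g) ∈ S} ∂init ≤
        e * ∫⁻ θ, DPFest.dpSGD (grad r) r γ C σ η B D' T θ {g | (r, θ, g) ∈ S} ∂init +
          ENNReal.ofReal δ := by
      intro r
      calc _ ≤ ∫⁻ θ, (e * DPFest.dpSGD (grad r) r γ C σ η B D' T θ {g | (r, θ, g) ∈ S} +
            ENNReal.ofReal δ) ∂init :=
            lintegral_mono fun θ => DPFest.dpSGD_le (hgrad r) r η hγ.le hγ1 hC B T hPQ hQP h θ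
              ((measurable_prodMk_left.comp measurable_prodMk_left) hS)
        _ = _ := by
            rw [lintegral_add_right _ measurable_const,
              lintegral_const_mul' _ _ ENNReal.ofReal_ne_top, lintegral_const, measure_univ,
              mul_one]
    -- The selection `r` is weighted by its probability under `D` in the additive term, where its
    -- total mass is at most `1`, and under `D'` only in the multiplicative one.
    calc _ ≤ ∫⁻ r, (e * ∫⁻ θ, DPFest.dpSGD (grad r) r γ C σ η B D' T θ
            {g | (r, θ, g) ∈ S} ∂init + ENNReal.ofReal δ) ∂(DPFest.selectBuckets bucket k b D) :=
          lintegral_mono hstep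
      _ = e * (∫⁻ r, ∫⁻ θ, DPFest.dpSGD (grad r) r γ C σ η B D' T θ
            {g | (r, θ, g) ∈ S} ∂init ∂(DPFest.selectBuckets bucket k b D)) +
            ENNReal.ofReal δ * DPFest.selectBuckets bucket k b D Set.univ := by
          rw [lintegral_add_right _ measurable_const,
            lintegral_const_mul' _ _ ENNReal.ofReal_ne_top, lintegral_const]
      _ ≤ e * (ENNReal.ofReal (Real.exp ε₁) * ∫⁻ r, ∫⁻ θ, DPFest.dpSGD (grad r) r γ C σ η B D' T θ
            {g | (r, θ, g) ∈ S} ∂init ∂(DPFest.selectBuckets bucket k b D')) +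
            ENNReal.ofReal δ * 1 := by
          gcongr
          · refine (lintegral_mono' (DPFest.selectBuckets_le bucket k hb hε₁ h) le_rfl).trans ?_
            rw [lintegral_smul_measure, smul_eq_mul]
          · exact DPFest.selectBuckets_univ_le_one bucket k hb D
      _ = _ := by
          rw [← mul_assoc, he, ← ENNReal.ofReal_mul (Real.exp_nonneg _), ← Real.exp_add,
            sub_add_cancel, mul_one]
  refine ⟨fun D D' h S _ => ?_, htranscript, fun D D' h S hS => ?_⟩
  · simpa using DPFest.selectBuckets_le bucket k hb hε₁ h S
  · have hm := DPFest.measurable_trainedModel (c := c) (d := d) (m := m) η T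
    simp only [Measure.map_apply hm hS]
    exact htranscript D D' h _ (hm hS)
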